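/- Let $A$ be a commutative noetherian ring with unit and let $f_1,\dots,f_n\in A$ be an $A$-sequence, i.e. a sequence that is regular in every order: for every permutation $\sigma$ of $\{1,\dots,n\}$ and every $i$, multiplication by $f_{\sigma(i)}$ on $A/(f_{\sigma(1)},\dots,f_{\sigma(i-1)})$ is injective. For a finite set $S$, an $S$-cube $x$ in an abelian category is a contravariant functor $T\mapsto x_T$ from the power set of $S$, ordered by inclusion. Its boundary morphisms are the maps $d_T^k\colon x_T\to x_{T\smallsetminus\{k\}}$ for $k\in T\subseteq S$. For $k\in S$, let $\mathrm{H}_0^k(x)$ be the $(S\smallsetminus\{k\})$-cube $T\mapsto \operatorname{Coker}\bigl(d^k_{T\cup\{k\}}\colon x_{T\cup\{k\}}\to x_T\bigr)$ with the induced maps. The cube $x$ is called admissible if all its boundary morphisms are monomorphisms and, recursively (when $\# S>1$), $\mathrm{H}_0^k(x)$ is admissible for every $k\in S$. (a) Let $m$ be a natural number and let $\mathfrak d=\{d_S^j\}_{S\subseteq\{1,\dots,n\},\, j\in S}$ be a family of endomorphisms of $A^{\oplus m}$ with $\det d_S^j=f_j$ for all $j\in S$, and with $d_{S\smallsetminus\{j\}}^k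 d_S^j=d_{S\smallsetminus\{k\}}^j d_S^k$ for all distinct $j,k\in S$. Let $\operatorname{Kos}(\mathfrak d)$ be the $n$-cube of $A$-modules (that is, the $\{1,\dots,n\}$-cube) with vertices $\operatorname{Kos}(\mathfrak d)_S=A^{\oplus m}$ and boundary morphisms $d_S^j$. Then $\operatorname{Kos}(\mathfrak d)$ is admissible. (b) Every Koszul cube associated with $f_1,\dots,f_n$ is admissible. Here a Koszul cube is an $n$-cube of $A$-modules whose vertices are finite free of one constant rank, for which there are positive integers $m_1,\dots,m_n$ such that $\det d_S^s=f_s^{m_s}$ for all $S\subseteq\{1,\dots,n\}$ and $s\in S$. The determinant is computed in bases of the vertices, so this equality is understood up to a unit. -/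

import Mathlib

open CategoryTheory CategoryTheory.Limits Opposite

universe u v w

namespace KoszulCube

/-- An `S`-cube in a category `C`: a contravariant functor to `C` from the power set of `S`,
ordered by inclusion. -/
abbrev Cube (S : Type u) (C : Type w) [Category.{v} C] := (Set S)ᵒᵖ ⥤ C

namespace Cube

variable {S : Type u} {C : Type w} [Category.{v} C]

/-- The morphism `x_T ⟶ x_{T ∖ {k}}`. For `k ∈ T` this is the boundary morphism `d_T^k` of `x`. -/
def boundary (x : Cube S C) (T : Set S) (k : S) : x.obj (op T) ⟶ x.obj (op (T \ {k})) :=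
  x.map (homOfLE (Set.sdiff_subset : T \ {k} ⊆ T)).op

/-- A subset of `S ∖ {k}`, regarded as a subset of `S`. -/
def incl (k : S) (T : Set {s : S // s ≠ k}) : Set S := Subtype.val '' T

theorem incl_mono (k : S) {T U : Set {s : S // s ≠ k}} (h : T ⊆ U) : incl k T ⊆ incl k U :=
  Set.image_mono h

/-- For `T ⊆ S ∖ {k}`, the boundary morphism `d_{T ∪ {k}}^k : x_{T ∪ {k}} ⟶ x_T`. -/
def edge (x : Cube S C) (k : S) (T : Set {s : S // s ≠ k}) :
    x.obj (op (insert k (incl k T))) ⟶ x.obj (op (incl k T)) :=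
  x.map (homOfLE (Set.subset_insert k (incl k T))).op

variable [Abelian C]

/-- The zeroth homology of `x` in direction `k`: the `S ∖ {k}`-cube
`T ↦ Coker (d_{T ∪ {k}}^k : x_{T ∪ {k}} ⟶ x_T)`, with the maps induced by those of `x`. -/
noncomputable def H0 (x : Cube S C) (k : S) : Cube {s : S // s ≠ k} C where
  obj T := cokernel (x.edge k T.unop)
  map {T U} g := cokernel.map (x.edge k T.unop) (x.edge k U.unop)
    (x.map (homOfLE (Set.insert_subset_insert (incl_mono k (leOfHom g.unop)))).op)
    (x.map (homOfLE (incl_mono k (leOfHom g.unop))).op)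
    (by
      unfold edge
      rw [← x.map_comp, ← x.map_comp]
      rfl)
  map_id T := by
    apply coequalizer.hom_ext
    simp
  map_comp {T U V} g h := by
    apply coequalizer.hom_ext
    have : (homOfLE (incl_mono k (leOfHom (g ≫ h).unop))).op =
      (homOfLE (incl_mono k (leOfHom g.unop))).op ≫
        (homOfLE (incl_mono k (leOfHom h.unop))).op := rfl
    simp [this]

/-- Admissible cubes (for finite `S`): all boundary morphisms are monomorphisms and, recursively,
all the cubes `H_0^k(x)`, `k ∈ S`, are admissible. If `S` has one element, the second condition is
void, since `H_0^k(x)` is then an `∅`-cube, which has no boundary morphisms and no directions. -/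
inductive IsAdmissible {C : Type w} [Category.{v} C] [Abelian C] :
    {S : Type u} → Cube S C → Prop
  | intro {S : Type u} (x : Cube S C)
      (mono : ∀ (T : Set S) (k : S), k ∈ T → Mono (x.boundary T k))
      (adm : ∀ k : S, IsAdmissible (x.H0 k)) : IsAdmissible x

end Cube

/-- `f_1, …, f_n` is an `A`-sequence: it is a regular sequence in every order, i.e. each
`f_{σ(i)}` is a nonzerodivisor on `A / (f_{σ(1)}, …, f_{σ(i-1)})`. The quotient
`A / (f_1, …, f_n)` is allowed to vanish. -/
def IsASequence {A : Type u} [CommRing A] {n : ℕ} (f : Fin n → A) : Prop :=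
  ∀ σ : Equiv.Perm (Fin n), RingTheory.Sequence.IsWeaklyRegular A (List.ofFn (f ∘ σ))

/-- A family of endomorphisms `d_S^j` of `A^m`, for `S ⊆ {1, …, n}` and `j ∈ S`, with
`det d_S^j = f_j`, which commute in the way needed for them to be the boundary maps of a cube.
The values `d S j` with `j ∉ S` are irrelevant and are never used. -/
structure Family {A : Type u} [CommRing A] {n : ℕ} (f : Fin n → A) (m : ℕ) where
  d : Set (Fin n) → Fin n → Module.End A (Fin m → A)
  comm : ∀ (S : Set (Fin n)) (j k : Fin n), j ∈ S → k ∈ S → j ≠ k →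
    d (S \ {j}) k ∘ₗ d S j = d (S \ {k}) j ∘ₗ d S k
  det : ∀ (S : Set (Fin n)) (j : Fin n), j ∈ S → LinearMap.det (d S j) = f j

namespace Family

variable {A : Type u} [CommRing A] {n : ℕ} {f : Fin n → A} {m : ℕ}

theorem ncard_lt {U T : Set (Fin n)} {k : Fin n} (hk : k ∈ T \ U) :
    ((T \ {k}) \ U).ncard < (T \ U).ncard := by
  apply Set.ncard_lt_ncard _ (Set.toFinite _)
  refine ⟨fun y hy => ⟨hy.1.1, hy.2⟩, fun h => (h hk).1.2 rfl⟩

open Classical in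
/-- For `U ⊆ T`, the composite `A^m = x_T ⟶ x_U = A^m` of the maps `d` that remove the elements
of `T ∖ U` one after the other (the order does not matter, see `trans_eq`). -/
noncomputable def trans (d : Family f m) (U T : Set (Fin n)) : Module.End A (Fin m → A) :=
  if h : (T \ U).Nonempty then d.trans U (T \ {h.some}) ∘ₗ d.d T h.some else LinearMap.id
termination_by (T \ U).ncard
decreasing_by exact ncard_lt h.some_mem

theorem trans_self (d : Family f m) (T : Set (Fin n)) : d.trans T T = LinearMap.id := by
  rw [trans]; simp

theorem trans_eq (d : Family f m) (U T : Set (Fin n)) (k : Fin n) (hk : k ∈ T \ U) :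
    d.trans U T = d.trans U (T \ {k}) ∘ₗ d.d T k := by
  induction hN : (T \ U).ncard using Nat.strong_induction_on generalizing T k with
  | _ N ih =>
    have h : (T \ U).Nonempty := ⟨k, hk⟩
    rw [trans, dif_pos h]
    have hs := h.some_mem
    generalize h.some = l at hs
    by_cases hkl : l = k
    · rw [hkl]
    · rw [ih _ (hN ▸ ncard_lt hs) (T \ {l}) k ⟨⟨hk.1, fun h => hkl h.symm⟩, hk.2⟩ rfl,
        ih _ (hN ▸ ncard_lt hk) (T \ {k}) l ⟨⟨hs.1, hkl⟩, hs.2⟩ rfl,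
        LinearMap.comp_assoc, LinearMap.comp_assoc, d.comm T l k hs.1 hk.1 hkl,
        Set.sdiff_sdiff_comm]

theorem trans_trans (d : Family f m) {V U T : Set (Fin n)} (hVU : V ⊆ U) (hUT : U ⊆ T) :
    d.trans V T = d.trans V U ∘ₗ d.trans U T := by
  induction hN : (T \ U).ncard using Nat.strong_induction_on generalizing T with
  | _ N ih =>
    by_cases h : (T \ U).Nonempty
    · obtain ⟨k, hk⟩ := h
      rw [d.trans_eq U T k hk, d.trans_eq V T k ⟨hk.1, fun h => hk.2 (hVU h)⟩,
        ih _ (hN ▸ ncard_lt hk) (Set.subset_sdiff_singleton hUT hk.2) rfl,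
        LinearMap.comp_assoc]
    · have : T = U := (Set.sdiff_eq_empty.1 (Set.not_nonempty_iff_eq_empty.1 h)).antisymm hUT
      rw [this, trans_self, LinearMap.comp_id]

/-- The cube `Kos(d)` with vertices `x_S = A^m` and boundary morphisms `d_S^j`
(see `cube_boundary`). -/
noncomputable def cube (d : Family f m) : Cube (Fin n) (ModuleCat.{u} A) where
  obj _ := ModuleCat.of A (Fin m → A)
  map {T U} _ := ModuleCat.ofHom (d.trans U.unop T.unop)
  map_id T := by rw [trans_self]; rfl
  map_comp {T U V} g h := by
    rw [d.trans_trans (leOfHom h.unop) (leOfHom g.unop)]; rfl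

theorem cube_boundary (d : Family f m) (T : Set (Fin n)) (k : Fin n) (hk : k ∈ T) :
    d.cube.boundary T k = ModuleCat.ofHom (d.d T k) := by
  have : d.trans (T \ {k}) T = d.d T k := by
    rw [d.trans_eq _ T k ⟨hk, fun h => h.2 rfl⟩, trans_self, LinearMap.id_comp]
  exact congrArg ModuleCat.ofHom this

end Family

/-- A Koszul cube associated with `f_1, …, f_n`: an `n`-cube of finite free `A`-modules of constant
rank `r` such that, for some positive integers `e_1, …, e_n`, every boundary morphism `d_T^s` has
determinant `f_s ^ e_s`. As usual for a map between two free modules of the same rank, the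
determinant is taken in bases of the vertices and is defined up to a unit; the choice of the bases
does not matter. -/
def IsKoszulCube {A : Type u} [CommRing A] {n : ℕ} (f : Fin n → A)
    (x : Cube (Fin n) (ModuleCat.{v} A)) : Prop :=
  ∃ (r : ℕ) (b : ∀ T : Set (Fin n), Module.Basis (Fin r) A (x.obj (op T))) (e : Fin n → ℕ),
    (∀ s, 0 < e s) ∧
    ∀ (T : Set (Fin n)) (s : Fin n), s ∈ T →
      Associated (LinearMap.toMatrix (b T) (b (T \ {s})) (x.boundary T s).hom).det (f s ^ e s)

end KoszulCube

namespace KoszulCube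

open Pointwise

/-! A boundary map whose determinant is `f k ^ e` up to a unit has, by the adjugate, a two-sided
inverse up to `f k ^ e`. Determinants do not pass to cokernels, which need not be free, but such
inverses do. Admissibility is therefore proved for the larger class `Cube.IsInvertibleUpTo`, where
the vertices are any modules on which `f` is regular in every order. Boundary maps are injective
there because `f k` is a nonzerodivisor, and the class is stable under `H0`: `IsRegularFamily.coker`
handles the vertices, and the inverses descend to the cokernels. Induction on the number of
directions concludes. Part (a) is the case of standard bases and exponents one. -/

/-- `f` is regular on `M` in every order: `f j` is a nonzerodivisor on `M / (f k, k ∈ K) M`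
whenever `j ∉ K`. -/
def IsRegularFamily {A : Type*} [CommRing A] {S : Type*} (f : S → A) (M : Type*)
    [AddCommGroup M] [Module A M] : Prop :=
  ∀ (K : Set S) (j : S), j ∉ K → ∀ m : M,
    f j • m ∈ Ideal.span (f '' K) • (⊤ : Submodule A M) →
      m ∈ Ideal.span (f '' K) • (⊤ : Submodule A M)

/-! ### Regularity in every order, for modules and cokernels -/

section Modules

variable {A : Type*} [CommRing A] {S : Type*} {f : S → A}
  {M X Y C : Type*} [AddCommGroup M] [Module A M] [AddCommGroup X] [Module A X]
  [AddCommGroup Y] [Module A Y] [AddCommGroup C] [Module A C]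

theorem map_mem_smul_top (φ : X →ₗ[A] Y) (I : Ideal A) {x : X}
    (hx : x ∈ I • (⊤ : Submodule A X)) : φ x ∈ I • (⊤ : Submodule A Y) :=
  Submodule.smul_top_le_comap_smul_top I φ hx

theorem IsRegularFamily.pow (h : IsRegularFamily f M) {K : Set S} {j : S} (hj : j ∉ K) (e : ℕ)
    {m : M} (hm : f j ^ e • m ∈ Ideal.span (f '' K) • (⊤ : Submodule A M)) :
    m ∈ Ideal.span (f '' K) • (⊤ : Submodule A M) := by
  induction e with
  | zero => simpa using hm
  | succ e ih =>
    rw [pow_succ', mul_smul] at hm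
    exact ih (h K j hj _ hm)

theorem IsRegularFamily.pow_smul_eq_zero (h : IsRegularFamily f M) (j : S) (e : ℕ) {m : M}
    (hm : f j ^ e • m = 0) : m = 0 := by
  simpa using h.pow (K := ∅) (Set.notMem_empty j) e (m := m) (by simp [hm])

theorem mem_span_insert_smul_top_iff {K : Set S} {j : S} {m : M} :
    m ∈ Ideal.span (f '' insert j K) • (⊤ : Submodule A M) ↔
      ∃ z : M, ∃ u ∈ Ideal.span (f '' K) • (⊤ : Submodule A M), m = f j • z + u := by
  rw [Set.image_insert_eq, Ideal.span_insert, Submodule.sup_smul,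
    Submodule.ideal_span_singleton_smul, Submodule.mem_sup]
  constructor
  · rintro ⟨y, hy, u, hu, rfl⟩
    obtain ⟨z, -, rfl⟩ := (Submodule.mem_smul_pointwise_iff_exists _ _ _).1 hy
    exact ⟨z, u, hu, rfl⟩
  · rintro ⟨z, u, hu, rfl⟩
    exact ⟨_, Submodule.smul_mem_pointwise_smul _ _ _ Submodule.mem_top, u, hu, rfl⟩

/-- If `d : X → Y` is invertible up to a power of `f k`, and `f` is regular in every order on `X`
and on `Y`, then the other members of `f` are regular in every order on the cokernel of `d`. -/
theorem IsRegularFamily.coker (hX : IsRegularFamily f X) (hY : IsRegularFamily f Y) {k : S} {e : ℕ}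
    {d : X →ₗ[A] Y} {g : Y →ₗ[A] X} {π : Y →ₗ[A] C} (hgd : ∀ x, g (d x) = f k ^ e • x)
    (hdπ : Function.Exact d π) (hπ : Function.Surjective π) :
    IsRegularFamily (fun s : {s // s ≠ k} => f s) C := by
  intro K j hj c hc
  have himg : (fun s : {s // s ≠ k} => f s) '' K = f '' (Subtype.val '' K) := by
    rw [Set.image_image]
  rw [himg] at hc ⊢
  have hjK : j.1 ∉ Subtype.val '' K := fun ⟨s, hs, h⟩ => hj (Subtype.ext h ▸ hs)
  have hkK : k ∉ insert j.1 (Subtype.val '' K) := by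
    rintro (h | ⟨s, -, h⟩)
    exacts [j.2 h.symm, s.2 h]
  obtain ⟨y, rfl⟩ := hπ c
  have htop : (⊤ : Submodule A C) = (⊤ : Submodule A Y).map π := by
    rw [Submodule.map_top, LinearMap.range_eq_top.2 hπ]
  rw [htop, ← Submodule.map_smul''] at hc
  obtain ⟨u, hu, huy⟩ := hc
  obtain ⟨x, hx⟩ := (hdπ (f j • y - u)).1 (by simp [huy])
  -- Applying `g` to `d x = f j • y - u` puts `f k ^ e • x` in the submodule generated by `j` and
  -- `K`; since `k` is outside, the power cancels.
  have hx' : x ∈ Ideal.span (f '' insert j.1 (Subtype.val '' K)) • (⊤ : Submodule A X) := by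
    refine hX.pow hkK e (mem_span_insert_smul_top_iff.2
      ⟨g y, -g u, neg_mem (map_mem_smul_top g _ hu), ?_⟩)
    rw [← hgd, hx, map_sub, map_smul, sub_eq_add_neg]
  obtain ⟨z, v, hv, rfl⟩ := mem_span_insert_smul_top_iff.1 hx'
  -- Subtracting `d z` does not change the class of `y` in `C`, and makes its multiple by `f j` lie
  -- in the submodule generated by `K`.
  have hy : y - d z ∈ Ideal.span (f '' (Subtype.val '' K)) • (⊤ : Submodule A Y) := by
    refine hY _ _ hjK _ ?_
    have : f j • (y - d z) = d v + u := by
      rw [map_add, map_smul] at hx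
      rw [smul_sub, sub_eq_iff_eq_add, sub_eq_iff_eq_add.1 hx.symm]
      abel
    rw [this]
    exact add_mem (map_mem_smul_top d _ hv) hu
  have := map_mem_smul_top π _ hy
  rwa [map_sub, hdπ.apply_apply_eq_zero, sub_zero] at this

theorem IsRegularFamily.of_basis {ι : Type*} [Finite ι] (h : IsRegularFamily f A)
    (b : Module.Basis ι A M) : IsRegularFamily f M := by
  have := Fintype.ofFinite ι
  intro K j hj m hm
  rw [← b.sum_repr m]
  refine sum_mem fun i _ => Submodule.smul_mem_smul ?_ Submodule.mem_top
  have := h K j hj (b.coord i m) (by simpa using map_mem_smul_top (b.coord i) _ hm)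
  simpa using this

end Modules

theorem IsASequence.isRegularFamily {A : Type*} [CommRing A] {n : ℕ} {f : Fin n → A}
    (hf : IsASequence f) : IsRegularFamily f A := by
  classical
  intro K j hj a ha
  -- The order to use: `K` first, then `j`, then everything else. Regularity at position `p.length`
  -- is then the claim.
  let p : List (Fin n) := K.toFinset.toList
  let l : List (Fin n) := p ++ j :: (insert j K)ᶜ.toFinset.toList
  have hnd : l.Nodup := by
    simp only [l, p, List.nodup_append, List.nodup_cons, Finset.nodup_toList, true_and, and_true]
    refine ⟨by simp, fun a ha b hb => ?_⟩
    rintro rfl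
    simp at ha hb
    grind
  have hmem : ∀ i, i ∈ l := by
    intro i
    simp [l, p]
    grind
  let E := hnd.getEquivOfForallMemList l hmem
  have hlen : n = l.length := by simpa using (Fintype.card_congr E).symm
  have hofFn : List.ofFn (f ∘ ((finCongr hlen).trans E)) = l.map f :=
    List.ext_getElem (by simp [← hlen]) fun i h₁ h₂ => by simp [E]
  have hreg := hf ((finCongr hlen).trans E)
  rw [hofFn] at hreg
  have hj' := hreg.regular_mod_prev p.length (by simp [l])
  have htake : (l.map f).take p.length = p.map f := by simp [l]
  have hget : (l.map f)[p.length]'(by simp [l]) = f j := by simp [l]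
  have hideal : Ideal.ofList (p.map f) = Ideal.span (f '' K) := by
    refine congrArg Ideal.span ?_
    ext
    simp [p]
  rw [hget, htake, hideal] at hj'
  rw [← Submodule.Quotient.mk_eq_zero] at ha ⊢
  exact hj'.right_eq_zero_of_smul ha

/-! ### Cubes with boundary maps invertible up to powers -/

namespace Cube

/-- A cube of modules on whose vertices `f` is regular in every order, and whose boundary
morphisms in direction `k` are invertible up to `f k ^ e k`. -/
structure IsInvertibleUpTo {A : Type u} [CommRing A] {S : Type w} (f : S → A) (e : S → ℕ)
    (x : Cube S (ModuleCat.{v} A)) : Prop where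
  regular : ∀ T, IsRegularFamily f (x.obj T)
  exists_inv : ∀ {T U : (Set S)ᵒᵖ} (φ : T ⟶ U) (k : S), T.unop ⊆ insert k U.unop →
    ∃ g : x.obj U ⟶ x.obj T,
      x.map φ ≫ g = (f k ^ e k) • 𝟙 _ ∧ g ≫ x.map φ = (f k ^ e k) • 𝟙 _

variable {A : Type u} [CommRing A] {S : Type w} {f : S → A} {e : S → ℕ}
  {x : Cube S (ModuleCat.{v} A)}

theorem IsInvertibleUpTo.mono (h : x.IsInvertibleUpTo f e) {T U : (Set S)ᵒᵖ} (φ : T ⟶ U) (k : S)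
    (hTU : T.unop ⊆ insert k U.unop) : Mono (x.map φ) := by
  obtain ⟨g, hg, -⟩ := h.exists_inv φ k hTU
  rw [ModuleCat.mono_iff_injective, injective_iff_map_eq_zero]
  intro m hm
  apply (h.regular T).pow_smul_eq_zero k (e k)
  have := congrArg (fun q => q.hom m) hg
  simpa [hm] using this.symm

theorem cokernel_map_comp_map_eq_smul {X X' Y Y' : ModuleCat.{v} A} {d : X ⟶ Y} {d' : X' ⟶ Y'}
    {p : X ⟶ X'} {q : Y ⟶ Y'} {p' : X' ⟶ X} {q' : Y' ⟶ Y} (h : d ≫ q = p ≫ d')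
    (h' : d' ≫ q' = p' ≫ d) {a : A} (hq : q ≫ q' = a • 𝟙 Y) :
    cokernel.map d d' p q h ≫ cokernel.map d' d p' q' h' = a • 𝟙 (cokernel d) := by
  apply coequalizer.hom_ext
  simp [cokernel.map, reassoc_of% hq]

theorem IsInvertibleUpTo.H0 (h : x.IsInvertibleUpTo f e) (k : S) :
    (x.H0 k).IsInvertibleUpTo (fun s : {s // s ≠ k} => f s)
      (fun s => e s) where
  regular T := by
    obtain ⟨g, hg, -⟩ := h.exists_inv
      (homOfLE (Set.subset_insert k (incl k T.unop))).op k subset_rfl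
    have hex := (ShortComplex.ShortExact.moduleCat_exact_iff_function_exact _).1
      (ShortComplex.exact_cokernel (x.edge k T.unop))
    exact (h.regular _).coker (h.regular _) (g := g.hom)
      (fun m => congrArg (fun q => q.hom m) hg) hex
      ((ModuleCat.epi_iff_surjective _).1 inferInstance)
  exists_inv {T U} φ j hTU := by
    have hincl : incl k T.unop ⊆ insert j.1 (incl k U.unop) := by
      rintro _ ⟨s, hs, rfl⟩
      rcases hTU hs with rfl | hs
      exacts [Or.inl rfl, Or.inr ⟨s, hs, rfl⟩]
    have hins : insert k (incl k T.unop) ⊆ insert j.1 (insert k (incl k U.unop)) := by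
      rw [Set.insert_comm]
      exact Set.insert_subset_insert hincl
    let φ₀ : op (incl k T.unop) ⟶ op (incl k U.unop) :=
      (homOfLE (incl_mono k (leOfHom φ.unop))).op
    let φ₁ : op (insert k (incl k T.unop)) ⟶ op (insert k (incl k U.unop)) :=
      (homOfLE (Set.insert_subset_insert (incl_mono k (leOfHom φ.unop)))).op
    obtain ⟨g₀, h₀, h₀'⟩ := h.exists_inv φ₀ j.1 hincl
    obtain ⟨g₁, h₁, h₁'⟩ := h.exists_inv φ₁ j.1 hins
    have hsq : x.map φ₁ ≫ x.edge k U.unop = x.edge k T.unop ≫ x.map φ₀ := by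
      unfold edge
      rw [← x.map_comp, ← x.map_comp]
      rfl
    -- The inverses are not assumed compatible with the edges. The square commutes because both
    -- sides, followed by the monomorphism `x.map φ₀`, equal `f j ^ e j` times the edge.
    have hmono := h.mono φ₀ j.1 hincl
    have hg : x.edge k U.unop ≫ g₀ = g₁ ≫ x.edge k T.unop := by
      rw [← cancel_mono (x.map φ₀), Category.assoc, Category.assoc, h₀', ← hsq,
        ← Category.assoc, h₁']
      simp
    exact ⟨cokernel.map _ _ g₁ g₀ hg, cokernel_map_comp_map_eq_smul hsq.symm hg h₀,
      cokernel_map_comp_map_eq_smul hg hsq.symm h₀'⟩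

theorem IsInvertibleUpTo.isAdmissible [Finite S] (h : x.IsInvertibleUpTo f e) :
    x.IsAdmissible := by
  induction hN : Nat.card S using Nat.strong_induction_on generalizing S with
  | _ N ih =>
    refine .intro x (fun T k _ => h.mono _ k ?_) fun k => ih _ ?_ (h.H0 k) rfl
    · rw [Set.insert_sdiff_singleton]
      exact Set.subset_insert k T
    · rw [← hN]
      exact Finite.card_subtype_lt (x := k) (by simp)

end Cube

/-! ### Koszul cubes -/

theorem exists_comp_eq_smul_of_associated_det {A M N ι : Type*} [CommRing A] [AddCommGroup M]
    [Module A M] [AddCommGroup N] [Module A N] [Fintype ι] [DecidableEq ι]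
    (b : Module.Basis ι A M) (c : Module.Basis ι A N) (d : M →ₗ[A] N) {a : A}
    (h : Associated (LinearMap.toMatrix b c d).det a) :
    ∃ g : N →ₗ[A] M, g ∘ₗ d = a • LinearMap.id ∧ d ∘ₗ g = a • LinearMap.id := by
  obtain ⟨u, rfl⟩ := h
  -- The factor `u` turns the determinant produced by the adjugate into `a`.
  refine ⟨Matrix.toLin c b ((u : A) • (LinearMap.toMatrix b c d).adjugate), ?_, ?_⟩
  · apply (LinearMap.toMatrix b b).injective
    rw [LinearMap.toMatrix_comp b c b, LinearMap.toMatrix_toLin, Matrix.smul_mul,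
      Matrix.adjugate_mul, map_smul, LinearMap.toMatrix_id, smul_smul, mul_comm]
  · apply (LinearMap.toMatrix c c).injective
    rw [LinearMap.toMatrix_comp c b c, LinearMap.toMatrix_toLin, Matrix.mul_smul,
      Matrix.mul_adjugate, map_smul, LinearMap.toMatrix_id, smul_smul, mul_comm]

theorem IsKoszulCube.isAdmissible {A : Type u} [CommRing A] {n : ℕ} {f : Fin n → A}
    (hf : IsASequence f) {x : Cube (Fin n) (ModuleCat.{v} A)} (hx : IsKoszulCube f x) :
    x.IsAdmissible := by
  obtain ⟨r, b, e, -, hdet⟩ := hx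
  refine Cube.IsInvertibleUpTo.isAdmissible (f := f) (e := e)
    ⟨fun T => hf.isRegularFamily.of_basis (b T.unop), ?_⟩
  rintro ⟨T⟩ ⟨U⟩ φ k hTU
  have hUT : U ⊆ T := leOfHom φ.unop
  change T ⊆ insert k U at hTU
  -- The condition on `T` and `U` also allows equality, where the map is an identity and the scalar
  -- itself is the inverse.
  by_cases hT : T = U
  · subst hT
    obtain rfl : φ = 𝟙 _ := Subsingleton.elim _ _
    exact ⟨(f k ^ e k) • 𝟙 _, by simp, by simp⟩
  · have hkT : k ∈ T := by
      by_contra hk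
      exact hT (((Set.subset_insert_iff_of_notMem hk).1 hTU).antisymm hUT)
    have hkU : k ∉ U := fun hk => hT ((Set.insert_eq_of_mem hk ▸ hTU).antisymm hUT)
    obtain rfl : U = T \ {k} := by
      ext s
      constructor
      · exact fun hs => ⟨hUT hs, fun h => hkU (h ▸ hs)⟩
      · exact fun hs => (hTU hs.1).resolve_left hs.2
    obtain ⟨g, hg, hg'⟩ := exists_comp_eq_smul_of_associated_det _ _ _ (hdet T k hkT)
    exact ⟨ModuleCat.ofHom g, ModuleCat.hom_ext hg, ModuleCat.hom_ext hg'⟩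

theorem Family.isKoszulCube {A : Type u} [CommRing A] {n : ℕ} {f : Fin n → A} {m : ℕ}
    (d : Family f m) : IsKoszulCube f d.cube := by
  refine ⟨m, fun _ => Pi.basisFun A (Fin m), fun _ => 1, fun _ => one_pos, fun T s hs => ?_⟩
  rw [d.cube_boundary T s hs, pow_one, ← d.det T s hs]
  erw [LinearMap.det_toMatrix (Pi.basisFun A (Fin m)) (d.d T s)]

end KoszulCube

theorem corollary6p2 {A : Type u} [CommRing A] [IsNoetherianRing A] {n : ℕ} (f : Fin n → A)
    (hf : KoszulCube.IsASequence f) :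
    (∀ (m : ℕ) (d : KoszulCube.Family f m), d.cube.IsAdmissible) ∧
    (∀ x : KoszulCube.Cube (Fin n) (ModuleCat.{v} A),
      KoszulCube.IsKoszulCube f x → x.IsAdmissible) :=
  ⟨fun _ d => d.isKoszulCube.isAdmissible hf, fun _ hx => hx.isAdmissible hf⟩
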